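/- Throughout, $p$ denotes a prime with $p>2$, and $\mathbb{E}_{x\in X}$ denotes $\frac1{|X|}\sum_{x\in X}$ (over $X=\mathbb{F}_p^n$ if $X$ is omitted). A *growth function* is an increasing function $\mathbb{R}^+\to\mathbb{R}^+$. A *quadratic factor* $\mathcal{B}$ on $\mathbb{F}_p^n$ of complexity $(\ell,q)$, with $\ell,q\ge 0$, consists of linearly independent vectors $r_1,\dots,r_\ell\in\mathbb{F}_p^n$ and symmetric $n\times n$ matrices $M_1,\dots,M_q$ over $\mathbb{F}_p$. Its *rank* is the minimum of $\mathrm{rk}(\lambda_1M_1+\dots+\lambda_qM_q)$ over all $(\lambda_1,\dots,\lambda_q)\in\mathbb{F}_p^q\setminus\{0\}$ (and $\infty$ if $q=0$). For $a=(a_1,\dots,a_{\ell+q})\in\mathbb{F}_p^{\ell+q}$ and $b\in\mathbb{F}_p^q$ let $$B(a)=\{x\in\mathbb{F}_p^n: x^Tr_i=a_i\ (1\le i\le \ell),\ x^TM_jx=a_{\ell+j}\ (1\le j\le q)\},$$ $$\beta(b)=\{(x,y)\in\mathbb{F}_p^n\times\mathbb{F}_p^n: x^TM_jy=b_j\ (1\le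 j\le q)\},$$ and let $\mu_{\beta(b)}(x,y)=1_{\beta(b)}(x,y)\,p^{2n}/|\beta(b)|$. For a tuple $$d=(a_1,a_2,a_3,b_{12},b_{13},b_{23})\in(\mathbb{F}_p^{\ell+q})^3\times(\mathbb{F}_p^{q})^3$$ and $f:\mathbb{F}_p^n\to\mathbb{C}$, the local semi-norm $\|f\|_{U^3(d)}\ge 0$ is defined by $$\|f\|_{U^3(d)}^8=\mathbb{E}_{x_0,x_1\in B(a_1)}\mathbb{E}_{y_0,y_1\in B(a_2)}\mathbb{E}_{z_0,z_1\in B(a_3)}\prod_{i,j\in\{0,1\}}\mu_{\beta(b_{12})}(x_i,y_j)\,\mu_{\beta(b_{13})}(x_i,z_j)\,\mu_{\beta(b_{23})}(y_i,z_j)\prod_{\omega\in\{0,1\}^3}\mathcal{C}^{|\omega|}f(x_{\omega(1)}+y_{\omega(2)}+z_{\omega(3)}),$$ where $\mathcal{C}$ is complex conjugation and $|\omega|$ is the number of ones in $\omega$ (the right-hand side is a nonnegative real number). **Statement.** For every $\varepsilon>0$ there is a polynomial growth function $\rho_0=\rho_0(\varepsilon)$, i.e. a growth function given by a real polynomial that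 depends only on $\varepsilon$, such that the following holds for all growth functions $\rho$ with $\rho\ge\rho_0$ pointwise and all primes $p>2$. Let $n\ge1$, let $f:\mathbb{F}_p^n\to[-1,1]$ satisfy $\|f\|_2=(\mathbb{E}_x|f(x)|^2)^{1/2}<\varepsilon$, and let $\mathcal{B}$ be a quadratic factor on $\mathbb{F}_p^n$ of complexity $(\ell,q)$ and rank at least $\rho(\ell+q)$. Then there is a set $\Gamma\subseteq(\mathbb{F}_p^{\ell+q})^3\times(\mathbb{F}_p^{q})^3$ with $|\Gamma|\ge(1-8\varepsilon)p^{3\ell+6q}$ such that $\|f\|_{U^3(d)}<2\varepsilon^{1/16}$ for every $d\in\Gamma$. -/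

import Mathlib

open Finset
open scoped BigOperators ENNReal

/-- A growth function `ℝ⁺ → ℝ⁺`: an increasing function on the positive reals with positive values.
It is represented by a function on `ℝ` of which only the values at positive arguments matter. -/
def IsGrowthFunction (σ : ℝ → ℝ) : Prop :=
  MonotoneOn σ (Set.Ioi 0) ∧ ∀ x, 0 < x → 0 < σ x

/-- The normalised `L²` norm `‖f‖₂ = (𝔼 |f|²)^{1/2}` of a function on `𝔽_p^n`. -/
noncomputable def normL2 {p n : ℕ} [NeZero p] (f : (Fin n → ZMod p) → ℂ) : ℝ :=
  Real.sqrt (𝔼 x, ‖f x‖ ^ 2)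

/-- A quadratic factor `(L, Q)` on `𝔽_p^n` of complexity `(ℓ, q)`: linearly independent vectors
`r₁, …, r_ℓ` and symmetric matrices `M₁, …, M_q`. -/
structure QuadraticFactor (p n ℓ q : ℕ) where
  r : Fin ℓ → Fin n → ZMod p
  linearIndependent_r : LinearIndependent (ZMod p) r
  M : Fin q → Matrix (Fin n) (Fin n) (ZMod p)
  isSymm_M : ∀ j, (M j).IsSymm

/-- A label `(a, b) ∈ 𝔽_p^ℓ × 𝔽_p^q = 𝔽_p^{ℓ+q}` of an atom. -/
abbrev AtomLabel (p ℓ q : ℕ) : Type := (Fin ℓ → ZMod p) × (Fin q → ZMod p)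

/-- A tuple of labels `(a₁, a₂, a₃, b₁₂, b₁₃, b₂₃)` in
`𝔽_p^{ℓ+q} × 𝔽_p^{ℓ+q} × 𝔽_p^{ℓ+q} × 𝔽_p^q × 𝔽_p^q × 𝔽_p^q`. -/
abbrev LabelTuple (p ℓ q : ℕ) : Type :=
  AtomLabel p ℓ q × AtomLabel p ℓ q × AtomLabel p ℓ q ×
    (Fin q → ZMod p) × (Fin q → ZMod p) × (Fin q → ZMod p)

/-- The characteristic measure `μ_β(x, y) = 1_β(x, y) |𝔽_p^n|² / |β|` of a set of pairs `β`. -/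
noncomputable def charMeasure {p n : ℕ} [NeZero p]
    (β : Finset ((Fin n → ZMod p) × (Fin n → ZMod p))) (x y : Fin n → ZMod p) : ℝ :=
  if (x, y) ∈ β then (Fintype.card (Fin n → ZMod p) : ℝ) ^ 2 / (#β : ℝ) else 0

namespace QuadraticFactor

variable {p n ℓ q : ℕ}

/-- The rank of the factor: the least rank of a linear combination `c₁ M₁ + ⋯ + c_q M_q` whose
coefficients are not all zero. It is `⊤` if `q = 0`, when there is no such combination. -/
noncomputable def rank (B : QuadraticFactor p n ℓ q) : ℕ∞ :=
  ⨅ (c : Fin q → ZMod p) (_ : c ≠ 0), ((∑ j, c j • B.M j).rank : ℕ∞)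

/-- The atom `B(a) = {x : xᵀ r_i = a_i for all i, xᵀ M_j x = a'_j for all j}` with label
`(a, a')`. -/
def atom [NeZero p] (B : QuadraticFactor p n ℓ q) (a : AtomLabel p ℓ q) :
    Finset (Fin n → ZMod p) :=
  {x | (∀ i, x ⬝ᵥ B.r i = a.1 i) ∧ ∀ j, x ⬝ᵥ (B.M j).mulVec x = a.2 j}

/-- The bilinear level set `β(b) = {(x, y) : xᵀ M_j y = b_j for all j}`. -/
def bilinearLevelSet [NeZero p] (B : QuadraticFactor p n ℓ q) (b : Fin q → ZMod p) :
    Finset ((Fin n → ZMod p) × (Fin n → ZMod p)) :=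
  {xy | ∀ j, xy.1 ⬝ᵥ (B.M j).mulVec xy.2 = b j}

/-- The local inner product `⟨(f_ω)_{ω ∈ {0,1}³}⟩_{U³(d)}`. The pairs `(x₀, x₁) ∈ B(a₁)²`,
`(y₀, y₁) ∈ B(a₂)²`, `(z₀, z₁) ∈ B(a₃)²` are functions on `Fin 2`, and `f_ω` is conjugated `|ω|`
times. -/
noncomputable def localU3Inner [NeZero p] (B : QuadraticFactor p n ℓ q) (d : LabelTuple p ℓ q)
    (f : (Fin 3 → Fin 2) → (Fin n → ZMod p) → ℂ) : ℂ :=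
  match d with
  | (a₁, a₂, a₃, b₁₂, b₁₃, b₂₃) =>
    𝔼 x ∈ Fintype.piFinset (fun _ : Fin 2 => B.atom a₁),
    𝔼 y ∈ Fintype.piFinset (fun _ : Fin 2 => B.atom a₂),
    𝔼 z ∈ Fintype.piFinset (fun _ : Fin 2 => B.atom a₃),
      (∏ i, ∏ j, (charMeasure (B.bilinearLevelSet b₁₂) (x i) (y j) : ℂ)) *
      (∏ i, ∏ k, (charMeasure (B.bilinearLevelSet b₁₃) (x i) (z k) : ℂ)) *
      (∏ j, ∏ k, (charMeasure (B.bilinearLevelSet b₂₃) (y j) (z k) : ℂ)) *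
      ∏ ω : Fin 3 → Fin 2,
        (starRingEnd ℂ)^[#{i | ω i = 1}] (f ω (x (ω 0) + y (ω 1) + z (ω 2)))

/-- The local semi-norm `‖f‖_{U³(d)} = ⟨(f)_ω⟩_{U³(d)}^{1/8}`. The inner product of copies of one
function is a nonnegative real number, so that it equals its absolute value. -/
noncomputable def localU3Norm [NeZero p] (B : QuadraticFactor p n ℓ q) (d : LabelTuple p ℓ q)
    (f : (Fin n → ZMod p) → ℂ) : ℝ :=
  ‖B.localU3Inner d (fun _ => f)‖ ^ (1 / 8 : ℝ)

end QuadraticFactor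

/-! ### Character sums over `ZMod p` and equidistribution of fibres. -/

section CharacterSums

variable {p : ℕ} [Fact p.Prime]

/-! The proof is a first moment argument over the labels `d`. Bound the product of the eight values
of `f` at the vertices of a cube by the product at two opposite vertices, hence by half the sum of
`f ^ 2` at these vertices. What remains is to count, for each `w`, all configurations, of any label,
whose chosen vertex is `w`. If this count is about the same for all `w`, then the average of
`‖f‖_{U³(d)}^8` over `d` is at most a constant times `𝔼 f ^ 2 ≤ ε ^ 2`, and Markov's inequality
bounds the number of labels with `‖f‖_{U³(d)} ≥ 2 ε^{1/16}`.

Letting the label vary removes the values of the forms from the conditions: what is left says that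
the forms agree along the configuration. In terms of the three differences `x₁ - x₀`, `y₁ - y₀`, `z₁
- z₀` and of `x₀`, `y₀` (with `z₀` eliminated through `w`), this gives `12 q` quadratic equations
with distinct leading monomials and `3 ℓ` linear ones. Such systems have the expected number of
solutions when the rank is large: `norm_sum_quadratic_le` bounds the exponential sums by Weyl
differencing, and `abs_card_system_sub_le` turns this into a count. The same lemma bounds the sizes
of atoms and bilinear level sets from below, which controls the normalising factors.
`sum_norm_localU3Inner_le` assembles the mean value bound. -/

theorem sum_stdAddChar_addMonoidHom {W : Type*} [AddCommGroup W] [Fintype W]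
    {L : W →+ ZMod p} (hL : L ≠ 0) : ∑ w, ZMod.stdAddChar (L w) = (0 : ℂ) := by
  have h : (ZMod.stdAddChar (N := p)).compAddMonoidHom L ≠ 1 := by
    intro h
    apply hL
    ext w
    have h1 : ZMod.stdAddChar (L w) = (1 : ℂ) := by
      simpa using DFunLike.congr_fun h w
    have h2 : ZMod.stdAddChar (L w) = (ZMod.stdAddChar (N := p)) 0 := by simpa using h1
    exact ZMod.injective_stdAddChar h2
  simpa using AddChar.sum_eq_zero_of_ne_one h

theorem norm_stdAddChar (x : ZMod p) : ‖ZMod.stdAddChar x‖ = 1 :=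
  AddChar.norm_apply _ _

/-- Weyl differencing for a function of degree two whose derivative in the direction `h` is
`b h` up to a constant. -/
theorem norm_sum_stdAddChar_sq_le {W : Type*} [AddCommGroup W] [Fintype W]
    (φ : W → ZMod p) (b : W → W →+ ZMod p) (g : W → ZMod p)
    (hφ : ∀ v h, φ (v + h) - φ v = b h v + g h) [DecidablePred fun h => b h = 0] :
    ‖∑ v, ZMod.stdAddChar (φ v)‖ ^ 2 ≤ (Fintype.card W : ℝ) * #{h | b h = 0} := by
  have key : ((‖∑ v, ZMod.stdAddChar (φ v)‖ ^ 2 : ℝ) : ℂ) =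
      ∑ h, ZMod.stdAddChar (g h) * ∑ v, ZMod.stdAddChar (b h v) := by
    push_cast
    rw [← Complex.conj_mul', map_sum, Finset.sum_mul_sum]
    simp_rw [Finset.mul_sum]
    rw [Finset.sum_comm (s := (univ : Finset W)) (t := (univ : Finset W))
      (f := fun h v => ZMod.stdAddChar (g h) * ZMod.stdAddChar (b h v))]
    refine Finset.sum_congr rfl fun v _ => ?_
    -- Expand the square as a double sum over `v` and `w`, and put `w = v + h`.
    rw [← Equiv.sum_comp (Equiv.addLeft v)]
    refine Finset.sum_congr rfl fun h _ => ?_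
    rw [← AddChar.map_neg_eq_conj, ← AddChar.map_add_eq_mul, ← AddChar.map_add_eq_mul]
    congr 1
    have := hφ v h
    simp only [Equiv.coe_addLeft]
    linear_combination this
  have h1 : ‖∑ v, ZMod.stdAddChar (φ v)‖ ^ 2 =
      ‖∑ h, ZMod.stdAddChar (g h) * ∑ v, (ZMod.stdAddChar (b h v) : ℂ)‖ := by
    rw [← key, Complex.norm_real, Real.norm_of_nonneg (by positivity)]
  rw [h1]
  calc _ ≤ ∑ h, ‖ZMod.stdAddChar (g h) * ∑ v, (ZMod.stdAddChar (b h v) : ℂ)‖ := norm_sum_le _ _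
    _ ≤ ∑ h, if b h = 0 then (Fintype.card W : ℝ) else 0 := by
      refine Finset.sum_le_sum fun h _ => ?_
      rw [norm_mul, norm_stdAddChar, one_mul]
      split_ifs with hb
      · simp [hb]
      · simp [sum_stdAddChar_addMonoidHom hb]
    _ = _ := by simp [← Finset.sum_filter, mul_comm]

/-- Fibres of a map into `𝔽_p^E` have nearly equal sizes if the nontrivial character sums of the map
are small. -/
theorem abs_card_fiber_sub_le {W E : Type*} [Fintype W] [Fintype E]
    (P : W → E → ZMod p) (D : ℝ)
    (hD : ∀ c : E → ZMod p, c ≠ 0 → ‖∑ w, ZMod.stdAddChar (∑ e, c e * P w e)‖ ≤ D)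
    (hD0 : 0 ≤ D) (a : E → ZMod p) [DecidablePred fun w => P w = a] :
    |(#{w | P w = a} : ℝ) - (Fintype.card W : ℝ) / (p : ℝ) ^ Fintype.card E| ≤ D := by
  classical
  have hp : (0 : ℝ) < (p : ℝ) ^ Fintype.card E := by
    have := (Fact.out : p.Prime).pos
    positivity
  have horth : ∀ u : E → ZMod p,
      ∑ c : E → ZMod p, (ZMod.stdAddChar (∑ e, c e * u e) : ℂ) =
        if u = 0 then (p : ℂ) ^ Fintype.card E else 0 := by
    intro u
    split_ifs with hu
    · simp [hu, ZMod.card]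
    · let L : (E → ZMod p) →+ ZMod p :=
        { toFun := fun c => ∑ e, c e * u e
          map_zero' := by simp
          map_add' := fun x y => by simp [add_mul, Finset.sum_add_distrib] }
      refine sum_stdAddChar_addMonoidHom (L := L) fun hL => hu ?_
      ext e
      have := DFunLike.congr_fun hL (Pi.single e 1)
      simpa [L, Pi.single_apply] using this
  have h1 : ((p : ℂ) ^ Fintype.card E) * #{w | P w = a} =
      ∑ c : E → ZMod p, ZMod.stdAddChar (-∑ e, c e * a e) *
        ∑ w, ZMod.stdAddChar (∑ e, c e * P w e) := by
    simp_rw [Finset.mul_sum]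
    rw [Finset.sum_comm]
    have : ∀ w, ∑ c : E → ZMod p, (ZMod.stdAddChar (-∑ e, c e * a e) : ℂ) *
        ZMod.stdAddChar (∑ e, c e * P w e) =
        if P w = a then (p : ℂ) ^ Fintype.card E else 0 := by
      intro w
      have := horth (P w - a)
      simp only [sub_eq_zero] at this
      rw [← this]
      refine Finset.sum_congr rfl fun c _ => ?_
      rw [← AddChar.map_add_eq_mul]
      congr 1
      simp [mul_sub, Finset.sum_sub_distrib]
      ring
    simp only [this]
    rw [← Finset.sum_filter, Finset.sum_const, nsmul_eq_mul, mul_comm]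
  have h2 : ((p : ℂ) ^ Fintype.card E) * #{w | P w = a} - Fintype.card W =
      ∑ c ∈ univ.erase (0 : E → ZMod p), ZMod.stdAddChar (-∑ e, c e * a e) *
        ∑ w, ZMod.stdAddChar (∑ e, c e * P w e) := by
    -- The frequency `c = 0` gives the main term.
    rw [h1, ← Finset.add_sum_erase _ _ (mem_univ 0)]
    simp
  have h3 : |((p : ℝ) ^ Fintype.card E) * #{w | P w = a} - Fintype.card W| ≤
      (p : ℝ) ^ Fintype.card E * D := by
    rw [← Real.norm_eq_abs, ← Complex.norm_real]
    push_cast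
    rw [h2]
    refine (norm_sum_le _ _).trans ?_
    calc _ ≤ ∑ c ∈ univ.erase (0 : E → ZMod p), D := by
          refine Finset.sum_le_sum fun c hc => ?_
          rw [norm_mul, norm_stdAddChar, one_mul]
          exact hD c (Finset.ne_of_mem_erase hc)
      _ ≤ ∑ c : E → ZMod p, D :=
          Finset.sum_le_sum_of_subset_of_nonneg (erase_subset _ _) fun _ _ _ => hD0
      _ = _ := by simp [ZMod.card]
  have h4 : (#{w | P w = a} : ℝ) - (Fintype.card W : ℝ) / (p : ℝ) ^ Fintype.card E =
      (((p : ℝ) ^ Fintype.card E) * #{w | P w = a} - Fintype.card W) /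
        (p : ℝ) ^ Fintype.card E := by
    field_simp
  rw [h4, abs_div, abs_of_pos hp, div_le_iff₀ hp]
  linarith

end CharacterSums

/-! ### Kernels of block linear systems. -/

section BlockSystems

variable {p n q : ℕ} [Fact p.Prime]

/-- One block with nonzero coefficients already forces the rank: varying only that block gives an
image of dimension at least `R`. -/
theorem card_block_kernel_mul_pow_le {I : Type*} [Fintype I] [DecidableEq I]
    (M : Fin q → Matrix (Fin n) (Fin n) (ZMod p)) (R : ℕ)
    (hR : ∀ c : Fin q → ZMod p, c ≠ 0 → R ≤ (∑ j, c j • M j).rank)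
    (c : I → Fin q → ZMod p) (hc : c ≠ 0)
    [DecidablePred fun h : I → Fin n → ZMod p => ∑ i, (∑ j, c i j • M j).mulVec (h i) = 0] :
    #{h : I → Fin n → ZMod p | ∑ i, (∑ j, c i j • M j).mulVec (h i) = 0} * p ^ R ≤
      p ^ (Fintype.card I * n) := by
  classical
  obtain ⟨i₀, hi₀⟩ := Function.ne_iff.1 hc
  let Φ : (I → Fin n → ZMod p) →ₗ[ZMod p] (Fin n → ZMod p) :=
    ∑ i, (Matrix.mulVecLin (∑ j, c i j • M j)).comp (LinearMap.proj i)
  have hΦ : ∀ h, Φ h = ∑ i, (∑ j, c i j • M j).mulVec (h i) := by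
    intro h; simp only [Φ, LinearMap.sum_apply, LinearMap.comp_apply, Matrix.mulVecLin_apply,
      LinearMap.proj_apply]
  have hrange : LinearMap.range (Matrix.mulVecLin (∑ j, c i₀ j • M j)) ≤ LinearMap.range Φ := by
    rintro _ ⟨x, rfl⟩
    refine ⟨Pi.single i₀ x, ?_⟩
    rw [hΦ, Finset.sum_eq_single i₀]
    · rw [Pi.single_eq_same, Matrix.mulVecLin_apply]
    · intro i _ hi
      simp [Pi.single_eq_of_ne hi]
    · simp
  have h1 : R ≤ Module.finrank (ZMod p) (LinearMap.range Φ) :=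
    (hR _ hi₀).trans (Submodule.finrank_mono hrange)
  have h2 := LinearMap.finrank_range_add_finrank_ker Φ
  have h3 : Module.finrank (ZMod p) (I → Fin n → ZMod p) = Fintype.card I * n := by
    simp [Module.finrank_pi_fintype]
  have h4 : #{h : I → Fin n → ZMod p | ∑ i, (∑ j, c i j • M j).mulVec (h i) = 0} =
      p ^ Module.finrank (ZMod p) (LinearMap.ker Φ) := by
    have := Module.card_eq_pow_finrank (K := ZMod p) (V := LinearMap.ker Φ)
    rw [ZMod.card] at this
    rw [← this, Fintype.card_subtype]
    simp [LinearMap.mem_ker, hΦ]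
  rw [h4, ← pow_add]
  exact Nat.pow_le_pow_right (Fact.out : p.Prime).pos (by omega)

end BlockSystems

/-! ### Exponential sums and solution counts for systems with distinct quadratic monomials. -/

section MonomialSystems

variable {p n ℓ q : ℕ} [Fact p.Prime]

theorem dotProduct_sum_smul_mulVec (M : Fin q → Matrix (Fin n) (Fin n) (ZMod p))
    (c : Fin q → ZMod p) (x y : Fin n → ZMod p) :
    x ⬝ᵥ (∑ j, c j • M j).mulVec y = ∑ j, c j * (x ⬝ᵥ (M j).mulVec y) := by
  simp [Matrix.sum_mulVec, Matrix.smul_mulVec, dotProduct_sum, dotProduct_smul]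

theorem dotProduct_mulVec_comm_of_isSymm {M : Matrix (Fin n) (Fin n) (ZMod p)} (hM : M.IsSymm)
    (x y : Fin n → ZMod p) : x ⬝ᵥ M.mulVec y = y ⬝ᵥ M.mulVec x := by
  rw [Matrix.dotProduct_mulVec, ← Matrix.mulVec_transpose, hM.eq, dotProduct_comm]

/-- After Weyl differencing only the kernel of the polar form matters. Its equations for one
suitable block involve a nonzero combination of the `M j`, so the kernel has codimension at least `2
* R`; the square root leaves `R`. -/
theorem norm_sum_quadratic_le {I S : Type*} [Fintype I] [LinearOrder I] [Fintype S]
    (hp2 : 2 < p) (M : Fin q → Matrix (Fin n) (Fin n) (ZMod p)) (hM : ∀ j, (M j).IsSymm) (R : ℕ)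
    (hR : ∀ c : Fin q → ZMod p, c ≠ 0 → 2 * R ≤ (∑ j, c j • M j).rank)
    (a b : S → I) (hab : ∀ s, a s ≤ b s) (hinj : ∀ s s', a s = a s' → b s = b s' → s = s')
    (c : S → Fin q → ZMod p) (hc : c ≠ 0) (Λ : (I → Fin n → ZMod p) →+ ZMod p) :
    ‖∑ v : I → Fin n → ZMod p, (ZMod.stdAddChar
      (∑ s, v (a s) ⬝ᵥ (∑ j, c s j • M j).mulVec (v (b s)) + Λ v) : ℂ)‖ ≤
      (p : ℝ) ^ (Fintype.card I * n) / (p : ℝ) ^ R := by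
  classical
  obtain ⟨s₀, hs₀⟩ := Function.ne_iff.1 hc
  set B : S → Matrix (Fin n) (Fin n) (ZMod p) := fun s => ∑ j, c s j • M j with hB
  have hBs : ∀ s, (B s).IsSymm := by
    intro s
    simp only [hB, Matrix.IsSymm, Matrix.transpose_sum, Matrix.transpose_smul, (hM _).eq]
  let D : (I → Fin n → ZMod p) → (I → Fin n → ZMod p) →+ ZMod p := fun h =>
    { toFun := fun v =>
        ∑ s, (v (a s) ⬝ᵥ (B s).mulVec (h (b s)) + v (b s) ⬝ᵥ (B s).mulVec (h (a s)))
      map_zero' := by simp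
      map_add' := fun v w => by
        rw [← Finset.sum_add_distrib]
        refine Finset.sum_congr rfl fun s _ => ?_
        simp only [Pi.add_apply, add_dotProduct]
        ring }
  have hD : ∀ h v, D h v =
      ∑ s, (v (a s) ⬝ᵥ (B s).mulVec (h (b s)) + v (b s) ⬝ᵥ (B s).mulVec (h (a s))) :=
    fun _ _ => rfl
  have hp0 : (0 : ℝ) < p := by exact_mod_cast (Fact.out : p.Prime).pos
  have hweyl := norm_sum_stdAddChar_sq_le
    (fun v : I → Fin n → ZMod p => ∑ s, v (a s) ⬝ᵥ (B s).mulVec (v (b s)) + Λ v) D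
    (fun h => ∑ s, h (a s) ⬝ᵥ (B s).mulVec (h (b s)) + Λ h) (by
      intro v h
      have : ∀ s, (v + h) (a s) ⬝ᵥ (B s).mulVec ((v + h) (b s)) =
          v (a s) ⬝ᵥ (B s).mulVec (v (b s)) +
          (v (a s) ⬝ᵥ (B s).mulVec (h (b s)) + v (b s) ⬝ᵥ (B s).mulVec (h (a s))) +
          h (a s) ⬝ᵥ (B s).mulVec (h (b s)) := by
        intro s
        rw [dotProduct_mulVec_comm_of_isSymm (hBs s) (v (b s))]
        simp only [Pi.add_apply, add_dotProduct, Matrix.mulVec_add, dotProduct_add]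
        ring
      rw [hD]
      simp only [this, Finset.sum_add_distrib, map_add]
      ring)
  -- the kernel of the polar form is cut out by the equations for the index `a s₀`
  let C : I → Fin q → ZMod p := fun i =>
    ∑ s, ((if a s = a s₀ ∧ b s = i then c s else 0) + (if b s = a s₀ ∧ a s = i then c s else 0))
  have hC : C ≠ 0 := by
    refine Function.ne_iff.2 ⟨b s₀, ?_⟩
    have h1 : ∀ s, (if a s = a s₀ ∧ b s = b s₀ then c s else 0) = if s = s₀ then c s else 0 := by
      intro s
      congr 1
      exact propext ⟨fun h => hinj _ _ h.1 h.2, fun h => by simp [h]⟩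
    -- As `a ≤ b`, a monomial can match `s₀` with its indices swapped only if it is `s₀` itself and
    -- is diagonal.
    have h2 : ∀ s, (if b s = a s₀ ∧ a s = b s₀ then c s else 0) =
        if s = s₀ then (if a s₀ = b s₀ then c s else 0) else 0 := by
      intro s
      by_cases hs : s = s₀
      · subst hs
        by_cases h : a s = b s <;> simp [h]
      · rw [if_neg hs, if_neg]
        rintro ⟨h, h'⟩
        have h3 := hab s
        rw [h, h'] at h3
        have h4 := le_antisymm h3 (hab s₀)
        exact hs (hinj _ _ (by rw [h', h4]) (by rw [h, h4]))
    have h3 : C (b s₀) = c s₀ + if a s₀ = b s₀ then c s₀ else 0 := by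
      simp only [C, Finset.sum_add_distrib, h1, h2, Finset.sum_ite_eq', mem_univ, if_true]
    rw [h3]
    split_ifs with h
    -- A diagonal monomial contributes twice to the polar form; this is where `p` must be odd.
    · rw [← two_smul (ZMod p)]
      have h2 : (2 : ZMod p) ≠ 0 := by
        intro h
        have h5 : ((2 : ℕ) : ZMod p) = 0 := by exact_mod_cast h
        rw [ZMod.natCast_eq_zero_iff] at h5
        exact absurd (Nat.le_of_dvd (by norm_num) h5) (by omega)
      exact smul_ne_zero h2 hs₀
    · simpa using hs₀
  have hker : ∀ h, D h = 0 → ∑ i, (∑ j, C i j • M j).mulVec (h i) = 0 := by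
    intro h hh
    refine dotProduct_eq_zero _ fun x => ?_
    -- Vectors supported on the block `a s₀` isolate its equation.
    have h1 := DFunLike.congr_fun hh (Pi.single (a s₀) x)
    rw [hD] at h1
    have h2 : ∀ i, ∑ j, C i j • M j =
        ∑ s, ((if a s = a s₀ ∧ b s = i then B s else 0) +
          (if b s = a s₀ ∧ a s = i then B s else 0)) := by
      intro i
      simp only [C, Finset.sum_apply, Finset.sum_smul]
      rw [Finset.sum_comm]
      refine Finset.sum_congr rfl fun s _ => ?_
      simp only [Pi.add_apply, add_smul, Finset.sum_add_distrib]
      congr 1 <;> split_ifs <;> simp [hB]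
    rw [dotProduct_comm, dotProduct_sum]
    simp only [h2, Matrix.sum_mulVec, dotProduct_sum, Matrix.add_mulVec, dotProduct_add]
    rw [Finset.sum_comm]
    rw [AddMonoidHom.zero_apply] at h1
    rw [← h1]
    refine Finset.sum_congr rfl fun s _ => ?_
    rw [Finset.sum_add_distrib]
    congr 1
    · rw [Finset.sum_eq_single (b s)]
      · by_cases h3 : a s = a s₀ <;> simp [h3]
      · intro i _ hi
        simp [hi.symm]
      · simp
    · rw [Finset.sum_eq_single (a s)]
      · by_cases h3 : b s = a s₀ <;> simp [h3]
      · intro i _ hi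
        simp [hi.symm]
      · simp
  have hcard := card_block_kernel_mul_pow_le M (2 * R) hR C hC
  have hcardD : #{h | D h = 0} * p ^ (2 * R) ≤ p ^ (Fintype.card I * n) := by
    refine (Nat.mul_le_mul_right _ (Finset.card_le_card ?_)).trans hcard
    intro h hh
    simp only [mem_filter, mem_univ, true_and] at hh ⊢
    exact hker h hh
  have hcardD' : (#{h | D h = 0} : ℝ) ≤ (p : ℝ) ^ (Fintype.card I * n) / (p : ℝ) ^ (2 * R) := by
    rw [le_div_iff₀ (by positivity)]
    exact_mod_cast hcardD
  have hW : (Fintype.card (I → Fin n → ZMod p) : ℝ) = (p : ℝ) ^ (Fintype.card I * n) := by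
    simp [ZMod.card, ← pow_mul, mul_comm]
  refine abs_le_of_sq_le_sq' ?_ (by positivity) |>.2
  refine hweyl.trans ?_
  rw [hW]
  refine (mul_le_mul_of_nonneg_left hcardD' (by positivity)).trans (le_of_eq ?_)
  simp only [div_pow, ← pow_mul, mul_comm R 2]
  ring

theorem exists_sum_dotProduct_ne_zero {I T : Type*} [DecidableEq I] [Fintype T]
    {r : Fin ℓ → Fin n → ZMod p} (hr : LinearIndependent (ZMod p) r)
    {g : T → I} (hg : Function.Injective g) {c : T → Fin ℓ → ZMod p} (hc : c ≠ 0) :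
    ∃ v : I → Fin n → ZMod p, ∑ t, ∑ i, c t i * (v (g t) ⬝ᵥ r i) ≠ 0 := by
  by_contra! hΘ
  obtain ⟨t₀, ht₀⟩ := Function.ne_iff.1 hc
  apply ht₀
  have h1 : ∑ i, c t₀ i • r i = 0 := by
    refine dotProduct_eq_zero _ fun x => ?_
    rw [← hΘ (Pi.single (g t₀) x), Finset.sum_eq_single t₀]
    · rw [dotProduct_comm, dotProduct_sum, Pi.single_eq_same]
      simp only [dotProduct_smul, smul_eq_mul]
    · intro t _ ht
      rw [Pi.single_eq_of_ne (hg.ne ht)]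
      simp only [zero_dotProduct, mul_zero, Finset.sum_const_zero]
    · exact fun h => absurd (mem_univ _) h
  funext i
  exact Fintype.linearIndependent_iff.1 hr _ h1 i

/-- Number of solutions of a system of quadratic equations whose quadratic parts are distinct
monomials `v_i ᵀ M_j v_{i'}`, together with linear equations `v_i ᵀ r_k = γ`. -/
theorem abs_card_system_sub_le {I S T : Type*} [Fintype I] [LinearOrder I] [Fintype S] [Fintype T]
    (hp2 : 2 < p) (B : QuadraticFactor p n ℓ q) (R : ℕ)
    (hR : ∀ c : Fin q → ZMod p, c ≠ 0 → 2 * R ≤ (∑ j, c j • B.M j).rank)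
    (a b : S → I) (hab : ∀ s, a s ≤ b s) (hinj : ∀ s s', a s = a s' → b s = b s' → s = s')
    (g : T → I) (hg : Function.Injective g)
    (Λ : S → Fin q → (I → Fin n → ZMod p) →+ ZMod p)
    (α : S → Fin q → ZMod p) (γ : T → Fin ℓ → ZMod p) :
    |(#{v : I → Fin n → ZMod p |
        (∀ s j, v (a s) ⬝ᵥ (B.M j).mulVec (v (b s)) + Λ s j v = α s j) ∧
          ∀ t i, v (g t) ⬝ᵥ B.r i = γ t i} : ℝ) -
      (p : ℝ) ^ (Fintype.card I * n) / (p : ℝ) ^ (Fintype.card S * q + Fintype.card T * ℓ)| ≤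
      (p : ℝ) ^ (Fintype.card I * n) / (p : ℝ) ^ R := by
  classical
  let P : (I → Fin n → ZMod p) → (S × Fin q) ⊕ (T × Fin ℓ) → ZMod p := fun v =>
    Sum.elim (fun s => v (a s.1) ⬝ᵥ (B.M s.2).mulVec (v (b s.1)) + Λ s.1 s.2 v)
      (fun t => v (g t.1) ⬝ᵥ B.r t.2)
  let A : (S × Fin q) ⊕ (T × Fin ℓ) → ZMod p := Sum.elim (fun s => α s.1 s.2) fun t => γ t.1 t.2
  have hbound : ∀ c : (S × Fin q) ⊕ (T × Fin ℓ) → ZMod p, c ≠ 0 →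
      ‖∑ v, (ZMod.stdAddChar (∑ e, c e * P v e) : ℂ)‖ ≤
        (p : ℝ) ^ (Fintype.card I * n) / (p : ℝ) ^ R := by
    intro c hc
    let cS : S → Fin q → ZMod p := fun s j => c (.inl (s, j))
    let cT : T → Fin ℓ → ZMod p := fun t i => c (.inr (t, i))
    let Θ : (I → Fin n → ZMod p) →+ ZMod p :=
      { toFun := fun v => ∑ t, ∑ i, cT t i * (v (g t) ⬝ᵥ B.r i)
        map_zero' := by simp
        map_add' := fun v w => by simp [add_dotProduct, mul_add, Finset.sum_add_distrib] }
    -- A purely linear frequency gives a sum that vanishes exactly, by linear independence of the `r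
    -- i`; any other is covered by the rank.
    by_cases hcS : cS = 0
    · have hcT : cT ≠ 0 := by
        intro h
        apply hc
        ext (⟨s, j⟩ | ⟨t, i⟩)
        · exact congr_fun (congr_fun hcS s) j
        · exact congr_fun (congr_fun h t) i
      have hφ : ∀ v, ∑ e, c e * P v e = Θ v := by
        intro v
        have h0 : ∀ s j, c (.inl (s, j)) = 0 := fun s j => congr_fun (congr_fun hcS s) j
        simp [Fintype.sum_sum_type, Fintype.sum_prod_type, h0, P, Θ, cT]
      have hΘ : Θ ≠ 0 := by
        obtain ⟨v, hv⟩ := exists_sum_dotProduct_ne_zero B.linearIndependent_r hg hcT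
        exact fun h => hv (DFunLike.congr_fun h v)
      simp only [hφ, sum_stdAddChar_addMonoidHom hΘ, norm_zero]
      positivity
    · let Ξ : (I → Fin n → ZMod p) →+ ZMod p :=
        { toFun := fun v => ∑ s, ∑ j, cS s j * Λ s j v
          map_zero' := by simp
          map_add' := fun v w => by simp [mul_add, Finset.sum_add_distrib] }
      have hφ : ∀ v, ∑ e, c e * P v e =
          ∑ s, v (a s) ⬝ᵥ (∑ j, cS s j • B.M j).mulVec (v (b s)) + (Ξ + Θ) v := by
        intro v
        have h1 : (Ξ + Θ) v = ∑ s, ∑ j, cS s j * Λ s j v +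
          ∑ t, ∑ i, cT t i * (v (g t) ⬝ᵥ B.r i) := rfl
        rw [h1]
        simp only [Fintype.sum_sum_type, Fintype.sum_prod_type, dotProduct_sum_smul_mulVec, P,
          Sum.elim_inl, Sum.elim_inr, mul_add, Finset.sum_add_distrib, cS, cT]
        ring
      simp only [hφ]
      exact norm_sum_quadratic_le hp2 B.M B.isSymm_M R hR a b hab hinj cS hcS _
  have hmain := abs_card_fiber_sub_le P _ hbound (by positivity) A
  have hW : (Fintype.card (I → Fin n → ZMod p) : ℝ) = (p : ℝ) ^ (Fintype.card I * n) := by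
    simp [ZMod.card, ← pow_mul, mul_comm]
  have hE : Fintype.card ((S × Fin q) ⊕ (T × Fin ℓ)) =
      Fintype.card S * q + Fintype.card T * ℓ := by simp
  rw [hW, hE] at hmain
  convert hmain using 5
  ext v
  simp [funext_iff, P, A]

end MonomialSystems

set_option synthInstance.maxSize 2000

namespace QuadraticFactor

/-! ### Sizes of atoms and bilinear level sets, and the number of configurations. -/

section Counting

variable {p n ℓ q : ℕ}

theorem pow_div_pow_le_tenth (hp2 : 2 < p) {k R : ℕ} (N : ℕ) (hk : k + 3 ≤ R) :
    (p : ℝ) ^ N / (p : ℝ) ^ R ≤ 1 / 10 * ((p : ℝ) ^ N / (p : ℝ) ^ k) := by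
  have hp : (3 : ℝ) ≤ p := by exact_mod_cast hp2
  have h0 : (0 : ℝ) < p := by linarith
  have h1 : (p : ℝ) ^ k * 10 ≤ (p : ℝ) ^ R := by
    calc (p : ℝ) ^ k * 10 ≤ (p : ℝ) ^ k * 3 ^ 3 := by gcongr; norm_num
      _ ≤ (p : ℝ) ^ k * (p : ℝ) ^ 3 := by gcongr
      _ = (p : ℝ) ^ (k + 3) := (pow_add _ _ _).symm
      _ ≤ (p : ℝ) ^ R := pow_le_pow_right₀ (by linarith) hk
  rw [div_mul_div_comm, one_mul, mul_comm]
  rw [mul_comm] at h1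
  rw [mul_comm]
  gcongr

variable [Fact p.Prime]

theorem le_card_atom (hp2 : 2 < p) (B : QuadraticFactor p n ℓ q) {R : ℕ}
    (hR : ∀ c : Fin q → ZMod p, c ≠ 0 → 2 * R ≤ (∑ j, c j • B.M j).rank)
    (hRk : q + ℓ + 3 ≤ R) (a : AtomLabel p ℓ q) :
    9 / 10 * ((p : ℝ) ^ n / (p : ℝ) ^ (q + ℓ)) ≤ #(B.atom a) := by
  have h := abs_card_system_sub_le (I := Unit) (S := Unit) (T := Unit) hp2 B R hR
    (fun _ => ()) (fun _ => ()) (fun _ => le_rfl) (fun _ _ _ _ => rfl) id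
    Function.injective_id (fun _ _ => 0) (fun _ => a.2) (fun _ => a.1)
  rw [Finset.card_bij (t := B.atom a) (fun v _ => v ()) ?_ ?_ ?_] at h
  rotate_left
  · intro v hv
    simp only [mem_filter, mem_univ, true_and, AddMonoidHom.zero_apply, add_zero] at hv
    simp only [atom, mem_filter, mem_univ, true_and]
    exact ⟨hv.2 (), hv.1 ()⟩
  · intro v _ w _ h
    funext _
    exact h
  · intro x hx
    simp only [atom, mem_filter, mem_univ, true_and] at hx
    refine ⟨fun _ => x, ?_, rfl⟩
    simp only [mem_filter, mem_univ, true_and, AddMonoidHom.zero_apply, add_zero]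
    exact ⟨fun _ => hx.2, fun _ => hx.1⟩
  simp only [Fintype.card_unit, one_mul] at h
  have h1 := pow_div_pow_le_tenth hp2 n hRk
  have h2 := (abs_le.1 h).1
  linarith

theorem le_card_bilinearLevelSet (hp2 : 2 < p) (B : QuadraticFactor p n ℓ q) {R : ℕ}
    (hR : ∀ c : Fin q → ZMod p, c ≠ 0 → 2 * R ≤ (∑ j, c j • B.M j).rank)
    (hRk : q + 3 ≤ R) (b : Fin q → ZMod p) :
    9 / 10 * ((p : ℝ) ^ (2 * n) / (p : ℝ) ^ q) ≤ #(B.bilinearLevelSet b) := by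
  have h := abs_card_system_sub_le (I := Fin 2) (S := Unit) (T := Empty) hp2 B R hR
    (fun _ => 0) (fun _ => 1) (fun _ => by decide) (fun _ _ _ _ => rfl) (fun _ => 0)
    (fun t => t.elim) (fun _ _ => 0) (fun _ => b) (fun t => t.elim)
  rw [Finset.card_bij (t := B.bilinearLevelSet b) (fun v _ => (v 0, v 1)) ?_ ?_ ?_] at h
  rotate_left
  · intro v hv
    simp only [mem_filter, mem_univ, true_and, AddMonoidHom.zero_apply, add_zero] at hv
    simp only [bilinearLevelSet, mem_filter, mem_univ, true_and]
    exact hv.1 ()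
  · intro v _ w _ h
    rw [Prod.mk.injEq] at h
    funext i
    fin_cases i
    exacts [h.1, h.2]
  · rintro ⟨x, y⟩ hx
    simp only [bilinearLevelSet, mem_filter, mem_univ, true_and] at hx
    refine ⟨![x, y], ?_, rfl⟩
    simp only [mem_filter, mem_univ, true_and, AddMonoidHom.zero_apply, add_zero]
    exact ⟨fun _ => hx, fun t => t.elim⟩
  simp only [Fintype.card_unit, Fintype.card_fin, Fintype.card_empty, one_mul, zero_mul,
    add_zero] at h
  have h1 := pow_div_pow_le_tenth hp2 (2 * n) hRk
  have h2 := (abs_le.1 h).1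
  linarith

/-- The pairs `x`, `y`, `z` lie in the atoms and in the bilinear level sets prescribed by `d`. -/
def IsConfiguration (B : QuadraticFactor p n ℓ q) (d : LabelTuple p ℓ q)
    (x y z : Fin 2 → Fin n → ZMod p) : Prop :=
  (∀ i, x i ∈ B.atom d.1) ∧ (∀ i, y i ∈ B.atom d.2.1) ∧ (∀ i, z i ∈ B.atom d.2.2.1) ∧
    (∀ i j, (x i, y j) ∈ B.bilinearLevelSet d.2.2.2.1) ∧
    (∀ i k, (x i, z k) ∈ B.bilinearLevelSet d.2.2.2.2.1) ∧
    ∀ j k, (y j, z k) ∈ B.bilinearLevelSet d.2.2.2.2.2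

/-- Coefficients of the linear terms of the equations for the differences `x₁ - x₀`, `y₁ - y₀`,
`z₁ - z₀` and the points `x₀`, `y₀` of a configuration with `x₀ + y₀ + z₀` given. -/
def configurationCoeff (p : ℕ) : Matrix (Fin 3) (Fin 5) (ZMod p) :=
  !![2, 0, 0, -1, 0; 0, 2, 0, 0, -1; 0, 0, 2, 0, 0]

/-- A difference is orthogonal, for each `M j`, to the points and differences of the other two
kinds. Hence pairing `x e' - x e` with `x e` equals pairing it with the whole sum `x e + y e + z e`,
and similarly for `y` and `z`. So equality of the values at the two endpoints becomes a square plus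
twice a linear term once the sum is fixed. -/
theorem IsConfiguration.difference_equations {B : QuadraticFactor p n ℓ q} {d : LabelTuple p ℓ q}
    {x y z : Fin 2 → Fin n → ZMod p} (h : B.IsConfiguration d x y z) (e e' : Fin 2)
    (s : Fin 3 × Fin 5) (hs : s.1.castLE (by norm_num) ≤ s.2) (j : Fin q) :
    ![x e' - x e, y e' - y e, z e' - z e, x e, y e] (s.1.castLE (by norm_num)) ⬝ᵥ
        (B.M j).mulVec (![x e' - x e, y e' - y e, z e' - z e, x e, y e] s.2) +
      configurationCoeff p s.1 s.2 *
        (![x e' - x e, y e' - y e, z e' - z e, x e, y e] (s.1.castLE (by norm_num)) ⬝ᵥ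
          (B.M j).mulVec (x e + y e + z e)) = 0 := by
  obtain ⟨hx, hy, hz, hxy, hxz, hyz⟩ := h
  simp only [atom, bilinearLevelSet, mem_filter, mem_univ, true_and] at hx hy hz hxy hxz hyz
  have hx' : ∀ i, x i ⬝ᵥ (B.M j).mulVec (x i) = _ := fun i => (hx i).2 j
  have hy' : ∀ i, y i ⬝ᵥ (B.M j).mulVec (y i) = _ := fun i => (hy i).2 j
  have hz' : ∀ i, z i ⬝ᵥ (B.M j).mulVec (z i) = _ := fun i => (hz i).2 j
  have hxy' : ∀ i k, x i ⬝ᵥ (B.M j).mulVec (y k) = _ := fun i k => hxy i k j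
  have hxz' : ∀ i k, x i ⬝ᵥ (B.M j).mulVec (z k) = _ := fun i k => hxz i k j
  have hyz' : ∀ i k, y i ⬝ᵥ (B.M j).mulVec (z k) = _ := fun i k => hyz i k j
  have hsymm := fun u v : Fin n → ZMod p =>
    dotProduct_mulVec_comm_of_isSymm (B.isSymm_M j) u v
  have hyx' : ∀ i k, y i ⬝ᵥ (B.M j).mulVec (x k) = _ := fun i k => (hsymm _ _).trans (hxy' k i)
  have hzx' : ∀ i k, z i ⬝ᵥ (B.M j).mulVec (x k) = _ := fun i k => (hsymm _ _).trans (hxz' k i)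
  have hzy' : ∀ i k, z i ⬝ᵥ (B.M j).mulVec (y k) = _ := fun i k => (hsymm _ _).trans (hyz' k i)
  obtain ⟨i, i'⟩ := s
  fin_cases i <;> fin_cases i' <;> first
    | exact absurd hs (by decide)
    | (simp [configurationCoeff, sub_dotProduct, dotProduct_sub, dotProduct_add,
        Matrix.mulVec_add, Matrix.mulVec_sub, hx', hy', hz', hxy', hxz', hyz', hyx', hzx', hzy',
        hsymm (x e) (x e'), hsymm (y e) (y e'), hsymm (z e) (z e')] <;> ring)

/-- The dot product with a fixed vector of a fixed block, times a constant. -/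
def blockForm {I : Type*} (i : I) (κ : ZMod p) (u : Fin n → ZMod p) :
    (I → Fin n → ZMod p) →+ ZMod p where
  toFun v := κ * (v i ⬝ᵥ u)
  map_zero' := by simp
  map_add' v w := by simp [add_dotProduct, mul_add]

-- The exponent counts constraints: three differences paired with themselves, three pairs of
-- distinct differences, and three differences against two base points make 12 equations per matrix;
-- the differences are also orthogonal to every `r i`.
open Classical in
theorem card_configuration_le (hp2 : 2 < p) (B : QuadraticFactor p n ℓ q) {R : ℕ}
    (hR : ∀ c : Fin q → ZMod p, c ≠ 0 → 2 * R ≤ (∑ j, c j • B.M j).rank)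
    (hRk : 12 * q + 3 * ℓ + 3 ≤ R) (e : Fin 2) (w : Fin n → ZMod p) :
    (#{t : LabelTuple p ℓ q × (Fin 2 → Fin n → ZMod p) × (Fin 2 → Fin n → ZMod p) ×
        (Fin 2 → Fin n → ZMod p) | B.IsConfiguration t.1 t.2.1 t.2.2.1 t.2.2.2 ∧
        t.2.1 e + t.2.2.1 e + t.2.2.2 e = w} : ℝ) ≤
      11 / 10 * ((p : ℝ) ^ (5 * n) / (p : ℝ) ^ (12 * q + 3 * ℓ)) := by
  obtain ⟨e', he'⟩ : ∃ e' : Fin 2, ∀ i, i = e ∨ i = e' := ⟨1 - e, by revert e; decide⟩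
  have h := abs_card_system_sub_le (I := Fin 5)
    (S := {s : Fin 3 × Fin 5 // s.1.castLE (by norm_num) ≤ s.2}) (T := Fin 3) hp2 B R hR
    (fun s => s.1.1.castLE (by norm_num)) (fun s => s.1.2) (fun s => s.2)
    (fun s s' h1 h2 => Subtype.ext (Prod.ext (Fin.castLE_injective _ h1) h2))
    (Fin.castLE (by norm_num)) (Fin.castLE_injective _)
    (fun s j => blockForm (s.1.1.castLE (by norm_num)) (configurationCoeff p s.1.1 s.1.2)
      ((B.M j).mulVec w)) (fun _ _ => 0) (fun _ _ => 0)
  have hS : Fintype.card {s : Fin 3 × Fin 5 // s.1.castLE (by norm_num) ≤ s.2} = 12 := by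
    decide
  simp only [hS, Fintype.card_fin] at h
  have h1 := pow_div_pow_le_tenth hp2 (5 * n) hRk
  have h2 := (abs_le.1 h).2
  refine le_trans ?_ (sub_le_iff_le_add.1 h2 |>.trans (by linarith))
  rw [Nat.cast_le]
  -- Injective because `w` returns the third base point, and the points of a configuration determine
  -- its label.
  refine Finset.card_le_card_of_injOn (fun t => ![t.2.1 e' - t.2.1 e, t.2.2.1 e' - t.2.2.1 e,
    t.2.2.2 e' - t.2.2.2 e, t.2.1 e, t.2.2.1 e]) ?_ ?_
  · rintro ⟨d, x, y, z⟩ ht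
    simp only [coe_filter, mem_univ, true_and, Set.mem_ofPred_eq] at ht ⊢
    obtain ⟨ht, rfl⟩ := ht
    refine ⟨fun s j => ht.difference_equations e e' s.1 s.2 j, fun t i => ?_⟩
    obtain ⟨hx, hy, hz, -⟩ := ht
    simp only [atom, mem_filter, mem_univ, true_and] at hx hy hz
    fin_cases t
    · exact (sub_dotProduct _ _ _).trans (by rw [(hx e).1, (hx e').1, sub_self])
    · exact (sub_dotProduct _ _ _).trans (by rw [(hy e).1, (hy e').1, sub_self])
    · exact (sub_dotProduct _ _ _).trans (by rw [(hz e).1, (hz e').1, sub_self])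
  · rintro ⟨d, x, y, z⟩ ht ⟨d', x', y', z'⟩ ht' heq
    simp only [coe_filter, mem_univ, true_and, Set.mem_ofPred_eq] at ht ht'
    have e0 := congr_fun heq 0
    have e1 := congr_fun heq 1
    have e2 := congr_fun heq 2
    have e3 : x e = x' e := congr_fun heq 3
    have e4 : y e = y' e := congr_fun heq 4
    have e5 : z e = z' e := by
      have := ht.2.trans ht'.2.symm
      rw [e3, e4] at this
      exact add_left_cancel this
    have f0 : x e' = x' e' := by simpa [e3] using e0
    have f1 : y e' = y' e' := by simpa [e4] using e1
    have f2 : z e' = z' e' := by simpa [e5] using e2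
    have hx : x = x' := funext fun i => by rcases he' i with rfl | rfl <;> assumption
    have hy : y = y' := funext fun i => by rcases he' i with rfl | rfl <;> assumption
    have hz : z = z' := funext fun i => by rcases he' i with rfl | rfl <;> assumption
    subst hx hy hz
    obtain ⟨a₁, a₂, a₃, b₁, b₂, b₃⟩ := d
    obtain ⟨a₁', a₂', a₃', b₁', b₂', b₃'⟩ := d'
    obtain ⟨⟨hx, hy, hz, hxy, hxz, hyz⟩, -⟩ := ht
    obtain ⟨⟨hx', hy', hz', hxy', hxz', hyz'⟩, -⟩ := ht'
    simp only [atom, bilinearLevelSet, mem_filter, mem_univ, true_and] at *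
    have g1 : a₁ = a₁' := Prod.ext (funext fun i => ((hx e).1 i).symm.trans ((hx' e).1 i))
      (funext fun i => ((hx e).2 i).symm.trans ((hx' e).2 i))
    have g2 : a₂ = a₂' := Prod.ext (funext fun i => ((hy e).1 i).symm.trans ((hy' e).1 i))
      (funext fun i => ((hy e).2 i).symm.trans ((hy' e).2 i))
    have g3 : a₃ = a₃' := Prod.ext (funext fun i => ((hz e).1 i).symm.trans ((hz' e).1 i))
      (funext fun i => ((hz e).2 i).symm.trans ((hz' e).2 i))
    have g4 : b₁ = b₁' := funext fun i => (hxy e e i).symm.trans (hxy' e e i)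
    have g5 : b₂ = b₂' := funext fun i => (hxz e e i).symm.trans (hxz' e e i)
    have g6 : b₃ = b₃' := funext fun i => (hyz e e i).symm.trans (hyz' e e i)
    subst g1 g2 g3 g4 g5 g6
    rfl

end Counting

end QuadraticFactor

/-! ### Mean value bound over all labels. -/

theorem norm_expect_le_of_le_card {ι : Type*} {s : Finset ι} {A : ℝ} (hA : 0 < A)
    (hs : A ≤ #s) {g : ι → ℂ} {G : ι → ℝ} (hg : ∀ i ∈ s, ‖g i‖ ≤ G i) :
    ‖𝔼 i ∈ s, g i‖ ≤ A⁻¹ * ∑ i ∈ s, G i := by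
  have h0 : 0 ≤ ∑ i ∈ s, G i := Finset.sum_nonneg fun i hi => (norm_nonneg _).trans (hg i hi)
  rw [Finset.expect_eq_sum_div_card, norm_div, Complex.norm_natCast, div_eq_inv_mul]
  have : ‖∑ i ∈ s, g i‖ ≤ ∑ i ∈ s, G i := (norm_sum_le _ _).trans (Finset.sum_le_sum hg)
  gcongr

theorem sum_sum_sum_sum_eq {α β γ δ : Type*} [Fintype α] [Fintype β] [Fintype γ] [Fintype δ]
    (φ : α → β → γ → δ → ℝ) :
    ∑ a, ∑ b, ∑ c, ∑ d, φ a b c d =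
      ∑ t : α × β × γ × δ, φ t.1 t.2.1 t.2.2.1 t.2.2.2 := by
  simp only [Fintype.sum_prod_type]

namespace QuadraticFactor

section Bounds

variable {p n ℓ q : ℕ} [Fact p.Prime]

theorem charMeasure_nonneg (β : Finset ((Fin n → ZMod p) × (Fin n → ZMod p)))
    (x y : Fin n → ZMod p) : 0 ≤ charMeasure β x y := by
  unfold charMeasure
  split_ifs <;> positivity

open Classical in
theorem prod_charMeasure_le {β : Finset ((Fin n → ZMod p) × (Fin n → ZMod p))} {K : ℝ}
    (hK : ∀ x y, charMeasure β x y ≤ K) (x y : Fin 2 → Fin n → ZMod p) :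
    ‖∏ i, ∏ j, (charMeasure β (x i) (y j) : ℂ)‖ ≤
      if ∀ i j, (x i, y j) ∈ β then K ^ 4 else 0 := by
  have h : ∀ i j, ‖(charMeasure β (x i) (y j) : ℂ)‖ = charMeasure β (x i) (y j) := fun i j => by
    rw [Complex.norm_real, Real.norm_of_nonneg (charMeasure_nonneg _ _ _)]
  simp only [norm_prod, h]
  split_ifs with hβ
  · calc _ ≤ ∏ i : Fin 2, ∏ j : Fin 2, K := by
          refine Finset.prod_le_prod (fun i _ => Finset.prod_nonneg fun j _ => ?_) fun i _ =>
            Finset.prod_le_prod (fun j _ => ?_) fun j _ => hK _ _ <;>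
          exact charMeasure_nonneg _ _ _
      _ = K ^ 4 := by simp [← pow_mul]
  · push Not at hβ
    obtain ⟨i, j, hij⟩ := hβ
    refine le_of_eq (Finset.prod_eq_zero (mem_univ i) (Finset.prod_eq_zero (mem_univ j) ?_))
    simp [charMeasure, hij]

/-- Keeping two opposite vertices instead of one yields `f ^ 2`, hence `ε ^ 2` in the mean value,
which leaves room for Markov's inequality. -/
theorem norm_prod_cube_le {f : (Fin n → ZMod p) → ℝ} (hf : ∀ x, f x ∈ Set.Icc (-1 : ℝ) 1)
    (x y z : Fin 2 → Fin n → ZMod p) :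
    ‖∏ ω : Fin 3 → Fin 2, (starRingEnd ℂ)^[#{i | ω i = 1}]
        ((fun x => (f x : ℂ)) (x (ω 0) + y (ω 1) + z (ω 2)))‖ ≤
      (∑ e, f (x e + y e + z e) ^ 2) / 2 := by
  have hconj : ∀ (k : ℕ) (r : ℝ), (starRingEnd ℂ)^[k] (r : ℂ) = r := by
    intro k r
    exact Function.iterate_fixed (Complex.conj_ofReal r) k
  simp only [hconj, norm_prod, Complex.norm_real, Real.norm_eq_abs]
  have h1 : ∀ x, |f x| ≤ 1 := fun x => abs_le.2 (hf x)
  rw [← Finset.mul_prod_erase univ _ (mem_univ (fun _ : Fin 3 => (0 : Fin 2))),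
    ← Finset.mul_prod_erase _ _ (show (fun _ : Fin 3 => (1 : Fin 2)) ∈ univ.erase
      (fun _ : Fin 3 => (0 : Fin 2)) by decide), Fin.sum_univ_two]
  set u := f (x 0 + y 0 + z 0)
  set v := f (x 1 + y 1 + z 1)
  refine (mul_le_mul_of_nonneg_left (mul_le_of_le_one_right (abs_nonneg _)
    (Finset.prod_le_one (fun _ _ => abs_nonneg _) fun _ _ => h1 _)) (abs_nonneg _)).trans ?_
  nlinarith [sq_nonneg (|u| - |v|), sq_abs u, sq_abs v]

open Classical in
theorem norm_localU3Inner_le (B : QuadraticFactor p n ℓ q) {A K : ℝ} (hA : 0 < A)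
    (hatom : ∀ a, A ≤ #(B.atom a))
    (hK : ∀ b x y, charMeasure (B.bilinearLevelSet b) x y ≤ K)
    {f : (Fin n → ZMod p) → ℝ} (hf : ∀ x, f x ∈ Set.Icc (-1 : ℝ) 1) (d : LabelTuple p ℓ q) :
    ‖B.localU3Inner d (fun _ x => (f x : ℂ))‖ ≤
      (A ^ 6)⁻¹ * K ^ 12 * ∑ x : Fin 2 → Fin n → ZMod p, ∑ y : Fin 2 → Fin n → ZMod p,
        ∑ z : Fin 2 → Fin n → ZMod p,
          if B.IsConfiguration d x y z then (∑ e, f (x e + y e + z e) ^ 2) / 2 else 0 := by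
  obtain ⟨a₁, a₂, a₃, b₁, b₂, b₃⟩ := d
  have hA2 : 0 < A ^ 2 := by positivity
  have hK0 : 0 ≤ K := (charMeasure_nonneg _ _ _).trans (hK 0 0 0)
  have hpi : ∀ a, A ^ 2 ≤ #(Fintype.piFinset fun _ : Fin 2 => B.atom a) := by
    intro a
    rw [Fintype.card_piFinset_const, Nat.cast_pow]
    exact pow_le_pow_left₀ hA.le (hatom a) 2
  let F : (Fin 2 → Fin n → ZMod p) → (Fin 2 → Fin n → ZMod p) → (Fin 2 → Fin n → ZMod p) → ℝ :=
    fun x y z => (∑ e, f (x e + y e + z e) ^ 2) / 2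
  let G : (Fin 2 → Fin n → ZMod p) → (Fin 2 → Fin n → ZMod p) → (Fin 2 → Fin n → ZMod p) → ℝ :=
    fun x y z => (if ∀ i j, (x i, y j) ∈ B.bilinearLevelSet b₁ then K ^ 4 else 0) *
      (if ∀ i k, (x i, z k) ∈ B.bilinearLevelSet b₂ then K ^ 4 else 0) *
      (if ∀ j k, (y j, z k) ∈ B.bilinearLevelSet b₃ then K ^ 4 else 0) * F x y z
  have key : ‖B.localU3Inner (a₁, a₂, a₃, b₁, b₂, b₃) (fun _ x => (f x : ℂ))‖ ≤
      (A ^ 2)⁻¹ * ∑ x ∈ Fintype.piFinset (fun _ : Fin 2 => B.atom a₁),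
        ((A ^ 2)⁻¹ * ∑ y ∈ Fintype.piFinset (fun _ : Fin 2 => B.atom a₂),
          ((A ^ 2)⁻¹ * ∑ z ∈ Fintype.piFinset (fun _ : Fin 2 => B.atom a₃), G x y z)) := by
    refine norm_expect_le_of_le_card hA2 (hpi _) fun x _ =>
      norm_expect_le_of_le_card hA2 (hpi _) fun y _ =>
      norm_expect_le_of_le_card hA2 (hpi _) fun z _ => ?_
    rw [norm_mul, norm_mul, norm_mul]
    refine mul_le_mul (mul_le_mul (mul_le_mul (prod_charMeasure_le (hK _) _ _)
      (prod_charMeasure_le (hK _) _ _) (norm_nonneg _) (by positivity))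
      (prod_charMeasure_le (hK _) _ _) (norm_nonneg _) (by positivity))
      (norm_prod_cube_le hf x y z) (norm_nonneg _) (by positivity)
  refine key.trans (le_of_eq ?_)
  have hG : ∀ x y z, (if x ∈ Fintype.piFinset (fun _ : Fin 2 => B.atom a₁) then
      if y ∈ Fintype.piFinset (fun _ : Fin 2 => B.atom a₂) then
      if z ∈ Fintype.piFinset (fun _ : Fin 2 => B.atom a₃) then G x y z else 0 else 0 else 0) =
      K ^ 12 * if B.IsConfiguration (a₁, a₂, a₃, b₁, b₂, b₃) x y z then F x y z else 0 := by
    intro x y z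
    have hc : B.IsConfiguration (a₁, a₂, a₃, b₁, b₂, b₃) x y z ↔
        (∀ i, x i ∈ B.atom a₁) ∧ (∀ i, y i ∈ B.atom a₂) ∧ (∀ i, z i ∈ B.atom a₃) ∧
          (∀ i j, (x i, y j) ∈ B.bilinearLevelSet b₁) ∧
          (∀ i k, (x i, z k) ∈ B.bilinearLevelSet b₂) ∧
          ∀ j k, (y j, z k) ∈ B.bilinearLevelSet b₃ := Iff.rfl
    simp only [hc, Fintype.mem_piFinset, G]
    by_cases h1 : ∀ i, x i ∈ B.atom a₁
    · by_cases h2 : ∀ i, y i ∈ B.atom a₂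
      · by_cases h3 : ∀ i, z i ∈ B.atom a₃
        · by_cases h4 : ∀ i j, (x i, y j) ∈ B.bilinearLevelSet b₁
          · by_cases h5 : ∀ i k, (x i, z k) ∈ B.bilinearLevelSet b₂
            · by_cases h6 : ∀ j k, (y j, z k) ∈ B.bilinearLevelSet b₃
              · rw [if_pos h1, if_pos h2, if_pos h3, if_pos h4, if_pos h5, if_pos h6,
                  if_pos ⟨h1, h2, h3, h4, h5, h6⟩]
                ring
              · simp only [h6, and_false, if_false, mul_zero, zero_mul, ite_self]
            · simp only [h5, and_false, false_and, if_false, mul_zero, zero_mul, ite_self]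
          · simp only [h4, and_false, false_and, if_false, mul_zero, zero_mul, ite_self]
        · simp only [h3, and_false, false_and, if_false, mul_zero, ite_self]
      · simp only [h2, and_false, false_and, if_false, mul_zero, ite_self]
    · simp only [h1, false_and, if_false, mul_zero]
  have hsum : ∑ x, ∑ y, ∑ z, (K ^ 12 *
      if B.IsConfiguration (a₁, a₂, a₃, b₁, b₂, b₃) x y z then F x y z else 0) =
      ∑ x ∈ Fintype.piFinset (fun _ : Fin 2 => B.atom a₁),
        ∑ y ∈ Fintype.piFinset (fun _ : Fin 2 => B.atom a₂),
          ∑ z ∈ Fintype.piFinset (fun _ : Fin 2 => B.atom a₃), G x y z := by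
    simp only [← hG]
    rw [← Finset.sum_subset (Finset.subset_univ
      (Fintype.piFinset (fun _ : Fin 2 => B.atom a₁)))]
    · refine Finset.sum_congr rfl fun x hx => ?_
      rw [← Finset.sum_subset (Finset.subset_univ
        (Fintype.piFinset (fun _ : Fin 2 => B.atom a₂)))]
      · refine Finset.sum_congr rfl fun y hy => ?_
        rw [← Finset.sum_subset (Finset.subset_univ
          (Fintype.piFinset (fun _ : Fin 2 => B.atom a₃)))]
        · refine Finset.sum_congr rfl fun z hz => ?_
          rw [if_pos hx, if_pos hy, if_pos hz]
        · intro z _ hz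
          simp only [hz, if_false, ite_self]
      · intro y _ hy
        simp only [hy, if_false, ite_self, Finset.sum_const_zero]
    · intro x _ hx
      simp only [hx, if_false, Finset.sum_const_zero]
  simp only [← Finset.mul_sum] at hsum ⊢
  rw [← hsum]
  simp only [F]
  ring

-- Each vertex `e` is treated separately, by sorting the configurations according to the value `w`
-- of their sum.
open Classical in
theorem sum_configurations_le (B : QuadraticFactor p n ℓ q) {N : ℝ}
    (hN : ∀ e w, (#{t : LabelTuple p ℓ q × (Fin 2 → Fin n → ZMod p) ×
        (Fin 2 → Fin n → ZMod p) × (Fin 2 → Fin n → ZMod p) |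
        B.IsConfiguration t.1 t.2.1 t.2.2.1 t.2.2.2 ∧
        t.2.1 e + t.2.2.1 e + t.2.2.2 e = w} : ℝ) ≤ N) (f : (Fin n → ZMod p) → ℝ) :
    ∑ d : LabelTuple p ℓ q, ∑ x : Fin 2 → Fin n → ZMod p, ∑ y : Fin 2 → Fin n → ZMod p,
        ∑ z : Fin 2 → Fin n → ZMod p,
          (if B.IsConfiguration d x y z then (∑ e, f (x e + y e + z e) ^ 2) / 2 else 0) ≤
      N * ∑ w, f w ^ 2 := by
  have h : ∀ e : Fin 2, ∑ t : LabelTuple p ℓ q × (Fin 2 → Fin n → ZMod p) ×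
        (Fin 2 → Fin n → ZMod p) × (Fin 2 → Fin n → ZMod p),
        (if B.IsConfiguration t.1 t.2.1 t.2.2.1 t.2.2.2 then
          f (t.2.1 e + t.2.2.1 e + t.2.2.2 e) ^ 2 else 0) ≤ N * ∑ w, f w ^ 2 := by
    intro e
    rw [← Finset.sum_fiberwise univ (fun t : LabelTuple p ℓ q × (Fin 2 → Fin n → ZMod p) ×
        (Fin 2 → Fin n → ZMod p) × (Fin 2 → Fin n → ZMod p) =>
        t.2.1 e + t.2.2.1 e + t.2.2.2 e), Finset.mul_sum]
    refine Finset.sum_le_sum fun w _ => ?_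
    refine le_trans (le_of_eq ?_) (mul_le_mul_of_nonneg_right (hN e w) (sq_nonneg _))
    rw [← Finset.sum_filter, Finset.filter_filter, ← nsmul_eq_mul, ← Finset.sum_const]
    refine Finset.sum_congr (by ext; simp [and_comm]) fun t ht => ?_
    rw [(mem_filter.1 ht).2.2]
  have h2 : ∀ d x y z, (if B.IsConfiguration d x y z then
      (∑ e, f (x e + y e + z e) ^ 2) / 2 else 0) =
      ∑ e, (if B.IsConfiguration d x y z then f (x e + y e + z e) ^ 2 else 0) / 2 := by
    intro d x y z
    split_ifs
    · rw [Finset.sum_div]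
    · simp
  have h3 : ∑ d : LabelTuple p ℓ q, ∑ x : Fin 2 → Fin n → ZMod p, ∑ y : Fin 2 → Fin n → ZMod p,
        ∑ z : Fin 2 → Fin n → ZMod p,
          (if B.IsConfiguration d x y z then (∑ e, f (x e + y e + z e) ^ 2) / 2 else 0) =
      ∑ e : Fin 2, (∑ t : LabelTuple p ℓ q × (Fin 2 → Fin n → ZMod p) ×
        (Fin 2 → Fin n → ZMod p) × (Fin 2 → Fin n → ZMod p),
        (if B.IsConfiguration t.1 t.2.1 t.2.2.1 t.2.2.2 then
          f (t.2.1 e + t.2.2.1 e + t.2.2.2 e) ^ 2 else 0)) / 2 := by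
    rw [sum_sum_sum_sum_eq]
    simp only [h2]
    rw [Finset.sum_comm]
    exact Finset.sum_congr rfl fun e _ => (Finset.sum_div _ _ _).symm
  rw [h3, Fin.sum_univ_two]
  linarith [h 0, h 1]

theorem card_labelTuple :
    (Fintype.card (LabelTuple p ℓ q) : ℝ) = (p : ℝ) ^ (3 * ℓ + 6 * q) := by
  simp only [Fintype.card_prod, Fintype.card_fun, ZMod.card, Fintype.card_fin, Nat.cast_mul,
    Nat.cast_pow]
  ring

/-- Mean value bound for the local `U³` inner products over all labels. -/
theorem sum_norm_localU3Inner_le (hp2 : 2 < p) (B : QuadraticFactor p n ℓ q) {R : ℕ}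
    (hR : ∀ c : Fin q → ZMod p, c ≠ 0 → 2 * R ≤ (∑ j, c j • B.M j).rank)
    (hRk : 12 * q + 3 * ℓ + 3 ≤ R)
    {f : (Fin n → ZMod p) → ℝ} (hf : ∀ x, f x ∈ Set.Icc (-1 : ℝ) 1) :
    ∑ d, ‖B.localU3Inner d (fun _ x => (f x : ℂ))‖ ≤
      8 * (p : ℝ) ^ (3 * ℓ + 6 * q) * 𝔼 x, f x ^ 2 := by
  classical
  have hp0 : (0 : ℝ) < p := by exact_mod_cast (Fact.out : p.Prime).pos
  set A : ℝ := 9 / 10 * ((p : ℝ) ^ n / (p : ℝ) ^ (q + ℓ)) with hAdef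
  set K : ℝ := 10 / 9 * (p : ℝ) ^ q with hKdef
  have hA : 0 < A := by positivity
  have hatom : ∀ a, A ≤ #(B.atom a) := B.le_card_atom hp2 hR (by omega)
  have hK : ∀ b x y, charMeasure (B.bilinearLevelSet b) x y ≤ K := by
    intro b x y
    have h := B.le_card_bilinearLevelSet hp2 hR (by omega) b
    have hpos : (0 : ℝ) < 9 / 10 * ((p : ℝ) ^ (2 * n) / (p : ℝ) ^ q) := by positivity
    unfold charMeasure
    split_ifs
    · rw [div_le_iff₀ (hpos.trans_le h)]
      refine le_trans (le_of_eq ?_) (mul_le_mul_of_nonneg_left h (by positivity))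
      simp only [Fintype.card_fun, ZMod.card, Fintype.card_fin, Nat.cast_pow, hKdef]
      field_simp
      ring
    · positivity
  have hN := B.card_configuration_le hp2 hR hRk
  calc _ ≤ ∑ d, _ := Finset.sum_le_sum fun d _ => B.norm_localU3Inner_le hA hatom hK hf d
    _ ≤ (A ^ 6)⁻¹ * K ^ 12 *
        (11 / 10 * ((p : ℝ) ^ (5 * n) / (p : ℝ) ^ (12 * q + 3 * ℓ)) * ∑ w, f w ^ 2) := by
      rw [← Finset.mul_sum]
      exact mul_le_mul_of_nonneg_left (B.sum_configurations_le hN f) (by positivity)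
    -- Six atoms and twelve bilinear measures lose a factor `10 / 9` each; the product is about
    -- `7.33`, below `8`.
    _ = (10 / 9) ^ 18 * (11 / 10) * (p : ℝ) ^ (3 * ℓ + 6 * q) * 𝔼 x, f x ^ 2 := by
      rw [Fintype.expect_eq_sum_div_card]
      simp only [Fintype.card_fun, ZMod.card, Fintype.card_fin, Nat.cast_pow, hAdef, hKdef]
      field_simp
      ring
    _ ≤ _ := by
      have : 0 ≤ 𝔼 x, f x ^ 2 := Finset.expect_nonneg fun _ _ => sq_nonneg _
      gcongr
      norm_num

/-- A nonzero `c` forces `q > 0`, so `ρ` is only used at a positive argument and the infinite rank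
for `q = 0` does no harm. -/
theorem le_rank_of_le {B : QuadraticFactor p n ℓ q} {ρ : ℝ → ℝ}
    (hρ : ∀ x : ℝ, 0 < x → 24 * x + 20 ≤ ρ x)
    (hB : ENNReal.ofReal (ρ ((ℓ : ℝ) + (q : ℝ))) ≤ (B.rank : ℝ≥0∞))
    (c : Fin q → ZMod p) (hc : c ≠ 0) :
    2 * (12 * (ℓ + q) + 10) ≤ (∑ j, c j • B.M j).rank := by
  have hq : 0 < q := by
    rcases Nat.eq_zero_or_pos q with rfl | h
    · exact absurd (Subsingleton.elim c 0) hc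
    · exact h
  have hpos : (0 : ℝ) < (ℓ : ℝ) + q := by positivity
  have h1 : (B.rank : ℝ≥0∞) ≤ (((∑ j, c j • B.M j).rank : ℕ) : ℝ≥0∞) := by
    have : B.rank ≤ ((∑ j, c j • B.M j).rank : ℕ∞) := iInf₂_le c hc
    exact_mod_cast ENat.toENNReal_le.2 this
  have h2 : ENNReal.ofReal (24 * ((ℓ : ℝ) + q) + 20) ≤ (((∑ j, c j • B.M j).rank : ℕ) : ℝ≥0∞) :=
    (ENNReal.ofReal_le_ofReal (hρ _ hpos)).trans (hB.trans h1)
  rw [ENNReal.ofReal_le_natCast] at h2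
  have h3 : ((2 * (12 * (ℓ + q) + 10) : ℕ) : ℝ) ≤ ((∑ j, c j • B.M j).rank : ℕ) := by
    push_cast
    linarith
  exact_mod_cast h3

end Bounds

end QuadraticFactor

/-! ### Conclusion by Markov's inequality. -/

theorem mainTheorem9 (ε : ℝ) (hε : 0 < ε) :
    ∃ ρ₀ : Polynomial ℝ, IsGrowthFunction (fun x => ρ₀.eval x) ∧
      ∀ ρ : ℝ → ℝ, IsGrowthFunction ρ → (∀ x, 0 < x → ρ₀.eval x ≤ ρ x) →
        ∀ (p : ℕ) [Fact p.Prime], 2 < p → ∀ n : ℕ, 1 ≤ n →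
          ∀ f : (Fin n → ZMod p) → ℝ, (∀ x, f x ∈ Set.Icc (-1 : ℝ) 1) →
            normL2 (fun x => (f x : ℂ)) < ε →
            ∀ (ℓ q : ℕ) (B : QuadraticFactor p n ℓ q),
              ENNReal.ofReal (ρ ((ℓ : ℝ) + (q : ℝ))) ≤ (B.rank : ℝ≥0∞) →
              ∃ Γ : Finset (LabelTuple p ℓ q),
                (1 - 8 * ε) * (p : ℝ) ^ (3 * ℓ + 6 * q) ≤ (#Γ : ℝ) ∧
                ∀ d ∈ Γ, B.localU3Norm d (fun x => (f x : ℂ)) < 2 * ε ^ (1 / 16 : ℝ) := by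
  classical
  -- This is `2 * R` for `R = 12 * (ℓ + q) + 10`, which exceeds the required `12 * q + 3 * ℓ + 3`.
  refine ⟨24 * Polynomial.X + 20, ⟨fun x _ y _ hxy => ?_, fun x hx => ?_⟩, ?_⟩
  · simpa using hxy
  · simp only [Polynomial.eval_add, Polynomial.eval_mul, Polynomial.eval_X,
      Polynomial.eval_ofNat]
    positivity
  intro ρ _ hρ p _ hp2 n _ f hf hfε ℓ q B hB
  have hp0 : (0 : ℝ) < p := by linarith [show (2 : ℝ) < p by exact_mod_cast hp2]
  rcases le_or_gt 1 ε with hε1 | hε1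
  · refine ⟨∅, ?_, by simp⟩
    rw [Finset.card_empty, Nat.cast_zero]
    exact mul_nonpos_of_nonpos_of_nonneg (by linarith) (by positivity)
  have hR := QuadraticFactor.le_rank_of_le (B := B) (ρ := ρ)
    (fun x hx => by simpa using hρ x hx) hB
  have hsum := B.sum_norm_localU3Inner_le hp2 hR (by omega) hf
  have hE : 𝔼 x, f x ^ 2 ≤ ε ^ 2 := by
    simp only [normL2, Complex.norm_real, Real.norm_eq_abs, sq_abs] at hfε
    exact ((Real.sqrt_lt' hε).1 hfε).le
  refine ⟨({d | B.localU3Norm d (fun x => (f x : ℂ)) < 2 * ε ^ (1 / 16 : ℝ)} : Finset _), ?_,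
    fun d hd => (mem_filter.1 hd).2⟩
  set bad : Finset (LabelTuple p ℓ q) :=
    {d | ¬ B.localU3Norm d (fun x => (f x : ℂ)) < 2 * ε ^ (1 / 16 : ℝ)} with hbad
  have hcard := Finset.card_filter_add_card_filter_not (s := (univ : Finset (LabelTuple p ℓ q)))
    (fun d => B.localU3Norm d (fun x => (f x : ℂ)) < 2 * ε ^ (1 / 16 : ℝ))
  rw [Finset.card_univ, ← hbad] at hcard
  have hcard' := congrArg (Nat.cast (R := ℝ)) hcard
  rw [Nat.cast_add, QuadraticFactor.card_labelTuple] at hcard'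
  -- each exceptional label contributes at least `256 ε` to the mean value bound
  have hlow : ∀ d ∈ bad, 256 * ε ≤ ‖B.localU3Inner d (fun _ x => (f x : ℂ))‖ := by
    intro d hd
    have h1 := not_lt.1 (mem_filter.1 hd).2
    have h2 := pow_le_pow_left₀ (by positivity) h1 8
    have h3 : B.localU3Norm d (fun x => (f x : ℂ)) ^ 8 =
        ‖B.localU3Inner d (fun _ x => (f x : ℂ))‖ := by
      unfold QuadraticFactor.localU3Norm
      rw [← Real.rpow_natCast, ← Real.rpow_mul (norm_nonneg _)]
      norm_num
    rw [h3] at h2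
    refine le_trans ?_ h2
    rw [mul_pow, ← Real.rpow_natCast, ← Real.rpow_natCast, ← Real.rpow_mul hε.le]
    -- The eighth power of the threshold is `256 ε^{1/2}`; as `ε < 1`, the weaker `256 ε` suffices.
    have h4 : ε ≤ ε ^ ((1 / 16 : ℝ) * ((8 : ℕ) : ℝ)) := by
      conv_lhs => rw [← Real.rpow_one ε]
      exact Real.rpow_le_rpow_of_exponent_ge hε hε1.le (by norm_num)
    have h5 : (2 : ℝ) ^ (((8 : ℕ) : ℝ)) = 256 := by
      rw [Real.rpow_natCast]; norm_num
    rw [h5]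
    linarith
  have hbadsum : (#bad : ℝ) * (256 * ε) ≤ 8 * (p : ℝ) ^ (3 * ℓ + 6 * q) * ε ^ 2 := by
    calc (#bad : ℝ) * (256 * ε) = ∑ d ∈ bad, 256 * ε := by rw [Finset.sum_const, nsmul_eq_mul]
      _ ≤ ∑ d ∈ bad, ‖B.localU3Inner d (fun _ x => (f x : ℂ))‖ := Finset.sum_le_sum hlow
      _ ≤ ∑ d, ‖B.localU3Inner d (fun _ x => (f x : ℂ))‖ :=
        Finset.sum_le_sum_of_subset_of_nonneg (subset_univ _) fun _ _ _ => norm_nonneg _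
      _ ≤ 8 * (p : ℝ) ^ (3 * ℓ + 6 * q) * 𝔼 x, f x ^ 2 := hsum
      _ ≤ _ := by gcongr
  have hfinal : (#bad : ℝ) ≤ 8 * ε * (p : ℝ) ^ (3 * ℓ + 6 * q) := by
    have hP : (0 : ℝ) < (p : ℝ) ^ (3 * ℓ + 6 * q) := by positivity
    have h6 : (#bad : ℝ) * (256 * ε) ≤ (1 / 32 * ε * (p : ℝ) ^ (3 * ℓ + 6 * q)) * (256 * ε) := by
      refine hbadsum.trans (le_of_eq ?_)
      ring
    have h7 := le_of_mul_le_mul_right h6 (by positivity)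
    nlinarith [mul_pos hε hP]
  linarith
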